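/- Let $\Delta$ be a simplicial tree on a finite vertex set $V$: a (nonempty) connected simplicial complex such that every nonempty subcollection of $\Delta$ (a simplicial complex whose facets are facets of $\Delta$) has a leaf, i.e. a facet $F$ that is either its only facet or for which there is another facet $G \neq F$ of the subcollection with $F \cap H \subseteq G$ for every facet $H \ne F$ of the subcollection. Let $k$ be a field. Then there are a polynomial ring $S = k[x_1,\dots,x_n]$, a monomial ideal $I \subseteq S$, and a bijection $v \mapsto m_v$ from $V$ onto the set of minimal monomial generators of $I$ such that, writing $m_F = \operatorname{lcm}(m_v : v \in F)$ for $F \subseteq V$ (with $m_\emptyset = 1$), the following hold. 1. $\Delta$ is the Scarf complex of $I$: a nonempty set $F \subseteq V$ is a face of $\Delta$ if and only if $m_{F'} \neq m_F$ for every subset $F' \subseteq V$ with $F' \neq F$. 2. $\Delta$, with this labelling, supports a minimal free resolution of $I$: for every total order on $V$ fixed in advance, the chain complex $\mathcal{C}(\Delta; S)$, which in homological degree $i \ge 0$ is the free $S$-module with basis $\{e_F : F \in \Delta,\ |F| = i\}$ (including $e_\emptyset$ in degree $0$), with differential $$\partial e_F = \sum_{v \in F} (-1)^{|\{w \in F \,:\,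 w < v\}|}\, \frac{m_F}{m_{F \setminus \{v\}}}\, e_{F \setminus \{v\}},$$ and with augmentation $S e_\emptyset \to S/I$, $e_\emptyset \mapsto 1$, is a free resolution of $S/I$, and it is minimal, i.e. the image of each differential is contained in $(x_1,\dots,x_n)$ times the next module. -/

import Mathlib

namespace SimplicialTree

open MvPolynomial

/-! ### Simplicial complexes and simplicial trees

Faces of Mathlib's `PreAbstractSimplicialComplex` and `AbstractSimplicialComplex` are nonempty;
the empty face is added by hand below where it plays a role. -/

section Trees

variable {V : Type*}

/-- The facets of a simplicial complex: its maximal faces under inclusion. -/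
def facets (K : PreAbstractSimplicialComplex V) : Set (Finset V) :=
  {F | Maximal (fun G : Finset V => G ∈ K) F}

/-- A facet `F` of `K` is a leaf if it is the only facet of `K`, or if some other facet `G`
contains the intersection of `F` with every facet `H ≠ F`, that is, if the intersection of `F`
with the subcomplex generated by the remaining facets is contained in `G`. -/
def IsLeaf [DecidableEq V] (K : PreAbstractSimplicialComplex V) (F : Finset V) : Prop :=
  F ∈ facets K ∧
    ((∀ G ∈ facets K, G = F) ∨
      ∃ G ∈ facets K, G ≠ F ∧ ∀ H ∈ facets K, H ≠ F → F ∩ H ⊆ G)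

/-- A subcollection of `Δ` is a simplicial complex all of whose facets are facets of `Δ`. -/
def IsSubcollection (K : PreAbstractSimplicialComplex V) (Δ : AbstractSimplicialComplex V) :
    Prop :=
  facets K ⊆ facets Δ.toPreAbstractSimplicialComplex

/-- The graph formed by the vertices and edges of `Δ`. -/
def edgeGraph (Δ : AbstractSimplicialComplex V) [DecidableEq V] : SimpleGraph V where
  Adj u v := u ≠ v ∧ ({u, v} : Finset V) ∈ Δ
  symm := ⟨fun u v h => ⟨h.1.symm, by rw [Finset.pair_comm]; exact h.2⟩⟩
  loopless := ⟨fun _ h => h.1 rfl⟩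

/-- A simplicial tree: a connected simplicial complex all of whose nonempty subcollections have
a leaf. -/
def IsTree [DecidableEq V] (Δ : AbstractSimplicialComplex V) : Prop :=
  (edgeGraph Δ).Connected ∧
    ∀ K : PreAbstractSimplicialComplex V, K.faces.Nonempty → IsSubcollection K Δ →
      ∃ F, IsLeaf K F

end Trees

/-! ### Monomial ideals and their Scarf complexes

A monomial is represented by its exponent vector `a : σ →₀ ℕ`. Divisibility of monomials is then
the pointwise order, and the least common multiple of a finite set of monomials is the supremum
of the exponent vectors (the supremum of the empty set is `0`, the exponent of the monomial `1`). -/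

section Monomial

variable {σ k : Type*} [Field k]

/-- A monomial ideal is an ideal generated by monomials. -/
def IsMonomialIdeal (I : Ideal (MvPolynomial σ k)) : Prop :=
  ∃ G : Set (σ →₀ ℕ), I = Ideal.span ((fun a => (monomial a (1 : k))) '' G)

/-- (The exponents of) the minimal monomial generators of a monomial ideal: the monomials in `I`
that are minimal with respect to divisibility. -/
def minGens (I : Ideal (MvPolynomial σ k)) : Set (σ →₀ ℕ) :=
  {a | Minimal (fun b : σ →₀ ℕ => monomial b (1 : k) ∈ I) a}

/-- The label of a finite set of labelled vertices: the least common multiple of the labels of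
its elements. -/
noncomputable def faceLabel {V : Type*} (m : V → (σ →₀ ℕ)) (A : Finset V) : σ →₀ ℕ :=
  A.sup m

/-- The Scarf complex of a monomial ideal: the vertices are the minimal monomial generators, and
a set of generators is a face if no other set of generators, the empty one included, has the same
least common multiple. -/
noncomputable def scarfComplex (I : Ideal (MvPolynomial σ k)) :
    PreAbstractSimplicialComplex (minGens I) where
  faces := {A | A.Nonempty ∧
    ∀ B : Finset (minGens I), faceLabel Subtype.val B = faceLabel Subtype.val A → B = A}
  isRelLowerSet_faces := by
    classical
    rintro A ⟨hA, hA'⟩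
    refine ⟨hA, fun B hBA hB => ⟨hB, fun C hC => ?_⟩⟩
    have hBA : B ⊆ A := hBA
    have hC : C.sup Subtype.val = B.sup Subtype.val := hC
    have key : C ∪ (A \ B) = A := by
      apply hA'
      simp only [faceLabel]
      rw [Finset.sup_union, hC, ← Finset.sup_union, Finset.union_sdiff_of_subset hBA]
    have hBC : B ⊆ C := fun b hb => by
      have hb' : b ∈ C ∪ (A \ B) := key.symm ▸ hBA hb
      simp only [Finset.mem_union, Finset.mem_sdiff] at hb'
      exact hb'.resolve_right fun h => h.2 hb
    refine Finset.Subset.antisymm (fun c hc => ?_) hBC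
    by_contra hcB
    have hcA : c ∈ A := key ▸ Finset.mem_union_left _ hc
    have h2 : A.erase c = A := by
      apply hA'
      simp only [faceLabel]
      apply le_antisymm (Finset.sup_mono (Finset.erase_subset _ _))
      refine Finset.sup_le fun a ha => ?_
      by_cases hac : a = c
      · have h3 : c.val ≤ B.sup Subtype.val := hC ▸ Finset.le_sup hc
        rw [hac]
        refine h3.trans (Finset.sup_mono fun b hb => Finset.mem_erase.2 ⟨?_, hBA hb⟩)
        rintro rfl
        exact hcB hb
      · exact Finset.le_sup (f := Subtype.val) (Finset.mem_erase.2 ⟨hac, ha⟩)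
    exact (Finset.mem_erase.1 (h2.symm ▸ hcA)).1 rfl

/-- The labelling `φ` of the vertices of `Δ` by the minimal monomial generators of `I` identifies
`Δ` with the Scarf complex of `I`. -/
def IsScarfComplexVia {V : Type*} (Δ : AbstractSimplicialComplex V)
    (I : Ideal (MvPolynomial σ k)) (φ : V ≃ minGens I) : Prop :=
  ∀ F : Finset V, F ∈ Δ ↔ F.map φ.toEmbedding ∈ scarfComplex I

end Monomial

/-! ### Free resolutions -/

/-- `⋯ → C 2 → C 1 → C 0 → M → 0` is a free resolution of the `R`-module `M`. -/
structure IsFreeResolution {R M : Type*} [CommRing R] [AddCommGroup M] [Module R M]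
    {C : ℕ → Type*} [∀ i, AddCommGroup (C i)] [∀ i, Module R (C i)]
    (d : ∀ i, C (i + 1) →ₗ[R] C i) (ε : C 0 →ₗ[R] M) : Prop where
  free : ∀ i, Module.Free R (C i)
  exact_succ : ∀ i, Function.Exact (d (i + 1)) (d i)
  exact_zero : Function.Exact (d 0) ε
  surjective : Function.Surjective ε

/-- A free resolution over a polynomial ring (with differentials homogeneous for some grading) is
minimal if the image of each differential lies in `𝔪 C i`, where `𝔪` is the ideal generated by
the variables. -/
structure IsMinimalFreeResolution {σ k M : Type*} [Field k] [AddCommGroup M]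
    [Module (MvPolynomial σ k) M]
    {C : ℕ → Type*} [∀ i, AddCommGroup (C i)] [∀ i, Module (MvPolynomial σ k) (C i)]
    (d : ∀ i, C (i + 1) →ₗ[MvPolynomial σ k] C i) (ε : C 0 →ₗ[MvPolynomial σ k] M) : Prop
    extends IsFreeResolution d ε where
  minimal : ∀ i, LinearMap.range (d i) ≤
    Ideal.span (Set.range (X : σ → MvPolynomial σ k)) • (⊤ : Submodule (MvPolynomial σ k) (C i))

/-! ### The labelled chain complex of a simplicial complex -/

section Cellular

variable {V : Type*} [LinearOrder V] (Δ : AbstractSimplicialComplex V)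

/-- The faces of `Δ` with `i` vertices, that is, of dimension `i - 1`, the empty face being the
only one with `0` vertices. -/
abbrev FaceOfCard (i : ℕ) : Type _ :=
  {F : Finset V // F.card = i ∧ (F = ∅ ∨ F ∈ Δ)}

/-- The face obtained from `F` by deleting the vertex `v`. -/
def FaceOfCard.erase {Δ : AbstractSimplicialComplex V} {i : ℕ} (F : FaceOfCard Δ (i + 1))
    (v : F.1) : FaceOfCard Δ i :=
  ⟨F.1.erase v, by
    obtain ⟨F, hF, hF'⟩ := F
    obtain ⟨v, hv⟩ := v
    refine ⟨by rw [Finset.card_erase_of_mem hv, hF]; rfl, ?_⟩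
    rcases Finset.eq_empty_or_nonempty (F.erase v) with h | h
    · exact Or.inl h
    · refine Or.inr ?_
      have hF' : F ∈ Δ.faces := hF'.resolve_left (Finset.ne_empty_of_mem hv)
      exact (Δ.isRelLowerSet_faces hF').2 (Finset.erase_subset v F) h⟩

variable {σ : Type*} (k : Type*) [Field k] (m : V → (σ →₀ ℕ))

/-- The module in homological degree `i` of the chain complex of `Δ` over `S = k[σ]`: the free
module on the faces with `i` vertices. -/
abbrev chains (σ : Type*) (i : ℕ) : Type _ :=
  FaceOfCard Δ i →₀ MvPolynomial σ k

/-- The differential of the chain complex of `Δ` labelled by the monomials with exponents `m`: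
`∂ F = ∑_{v ∈ F} ± (m_F / m_{F \ v}) • (F \ v)`, where the sign is `(-1) ^ j` if `v` is the vertex
number `j` of `F`, counted from `0` in increasing order, and `m_F` is the least common multiple of
the labels of the vertices of `F`. (The difference of exponents is never truncated, as
`m_{F \ v}` divides `m_F`.) -/
noncomputable def boundary (i : ℕ) :
    chains Δ k σ (i + 1) →ₗ[MvPolynomial σ k] chains Δ k σ i :=
  Finsupp.linearCombination (MvPolynomial σ k) fun F : FaceOfCard Δ (i + 1) =>
    ∑ v : F.1, Finsupp.single (F.erase v)
      (monomial (faceLabel m F.1 - faceLabel m (F.1.erase v))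
        ((-1 : k) ^ (F.1.filter (· < v.1)).card))

/-- The augmentation `S → S ⧸ I`, on the free module on the empty face. -/
noncomputable def augmentation (I : Ideal (MvPolynomial σ k)) :
    chains Δ k σ 0 →ₗ[MvPolynomial σ k] (MvPolynomial σ k ⧸ I) :=
  Finsupp.linearCombination (MvPolynomial σ k) fun _ => (1 : MvPolynomial σ k ⧸ I)

/-- `Δ`, with vertices labelled by the monomials with exponents `m`, supports a minimal free
resolution of `I`: its labelled chain complex is a minimal free resolution of `S ⧸ I`. -/
def SupportsMinimalResolution (I : Ideal (MvPolynomial σ k)) : Prop :=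
  IsMinimalFreeResolution (boundary Δ k m) (augmentation Δ k I)

end Cellular

end SimplicialTree

/-! Take one variable x_F for each face F of Δ, the empty face included, and let m_v be the product
of the x_F with v ∉ F. Then x_F divides m_A exactly when A ⊄ F. So a face A is recovered from m_A,
since x_A does not divide it, while all non-faces share the product of all variables as label. Hence
Δ is the Scarf complex unless there is exactly one non-face, that is, unless Δ is the boundary of a
simplex; `IsTree.exists_nonface_ne` rules this out by means of a leaf and connectedness.

The labelled complex splits by multidegree b into the simplicial chain complexes of the subcomplexes
of faces with label dividing x^b (`exists_labelledBoundary_eq`). By the choice of labels such a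
subcomplex is a full simplex on an intersection of faces, possibly just the empty face, or all of Δ
(`nearlyScarfLabel_subcomplex`). A nonempty simplex is a cone. A tree is acyclic by Mayer–Vietoris,
removing leaves one at a time: a leaf meets the other facets in a single simplex, which is nonempty
by connectedness (`IsTree.acyclic_generated`). Minimality holds because x_{A \ v} divides m_A but
not m_{A \ v}. -/

namespace SimplicialTree

open MvPolynomial

/-! ### Simplicial chains on the full simplex and acyclic families -/

section Chains

variable {V : Type*} [LinearOrder V] (k : Type*) [CommRing k]

/-- The sign of the vertex `v` relative to the set `A`: the parity of the number of elements of
`A` that are smaller than `v`. -/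
def vertexSign (v : V) (A : Finset V) : k :=
  (-1) ^ (A.filter (· < v)).card

variable {k}

lemma vertexSign_mul_self (v : V) (A : Finset V) : vertexSign k v A * vertexSign k v A = 1 := by
  rw [vertexSign, ← mul_pow]; simp

lemma vertexSign_insert_self (v : V) (A : Finset V) :
    vertexSign k v (insert v A) = vertexSign k v A := by
  simp [vertexSign, Finset.filter_insert]

lemma vertexSign_erase_self (v : V) (A : Finset V) :
    vertexSign k v (A.erase v) = vertexSign k v A := by
  rw [← vertexSign_insert_self, ← vertexSign_insert_self v A]
  congr 1
  ext x
  by_cases h : x = v <;> simp [h]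

lemma vertexSign_insert {v w : V} {A : Finset V} (hw : w ∉ A) :
    vertexSign k v (insert w A) = if w < v then -vertexSign k v A else vertexSign k v A := by
  unfold vertexSign
  rw [Finset.filter_insert]
  split_ifs
  · rw [Finset.card_insert_of_notMem (by simp [hw]), pow_succ]; ring
  · rfl

/-- Exactly one of the two vertices precedes the other, so exactly one of the two insertions flips a
sign. -/
lemma vertexSign_anticomm {v w : V} (hvw : v ≠ w) {A : Finset V} (hv : v ∉ A) (hw : w ∉ A) :
    vertexSign k w A * vertexSign k v (insert w A) =
      -(vertexSign k v A * vertexSign k w (insert v A)) := by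
  rw [vertexSign_insert hw, vertexSign_insert hv]
  rcases lt_or_gt_of_ne hvw with h | h
  · rw [if_neg h.not_gt, if_pos h]; ring
  · rw [if_pos h, if_neg h.not_gt]; ring

variable [Fintype V]

/-- The augmented simplicial boundary on the full simplex with vertex set `V`, where a chain is
given by its coefficients. -/
def simplexBoundary (f : Finset V → k) (A : Finset V) : k :=
  ∑ v ∈ Aᶜ, vertexSign k v A * f (insert v A)

/-- The cone with apex `v` on a chain of the full simplex. -/
def cone (v : V) (f : Finset V → k) (A : Finset V) : k :=
  if v ∈ A then vertexSign k v A * f (A.erase v) else 0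

lemma simplexBoundary_add (f g : Finset V → k) :
    simplexBoundary (f + g) = simplexBoundary f + simplexBoundary g := by
  ext A
  simp [simplexBoundary, mul_add, Finset.sum_add_distrib]

lemma simplexBoundary_sub (f g : Finset V → k) :
    simplexBoundary (f - g) = simplexBoundary f - simplexBoundary g := by
  ext A
  simp [simplexBoundary, mul_sub, Finset.sum_sub_distrib]

lemma simplexBoundary_zero : simplexBoundary (0 : Finset V → k) = 0 := by
  ext A
  simp [simplexBoundary]

/-- The terms cancel in pairs under exchanging the order in which two vertices are added to `A`. -/
lemma simplexBoundary_simplexBoundary (f : Finset V → k) :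
    simplexBoundary (simplexBoundary f) = 0 := by
  ext A
  simp only [simplexBoundary, Finset.mul_sum, Pi.zero_apply]
  rw [Finset.sum_sigma']
  refine Finset.sum_involution (fun p _ => ⟨p.2, p.1⟩) ?_ ?_ ?_ ?_
  · rintro ⟨w, v⟩ h
    simp only [Finset.mem_sigma, Finset.mem_compl, Finset.mem_insert, not_or] at h
    simp only [← mul_assoc]
    rw [vertexSign_anticomm h.2.1 h.2.2 h.1, Finset.insert_comm w v A]
    ring
  · rintro ⟨w, v⟩ h - h'
    simp only [Finset.mem_sigma, Finset.mem_compl, Finset.mem_insert, not_or] at h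
    exact h.2.1 (congrArg Sigma.fst h')
  · rintro ⟨w, v⟩ h
    simp only [Finset.mem_sigma, Finset.mem_compl, Finset.mem_insert, not_or] at h ⊢
    exact ⟨h.2.2, fun e => h.2.1 e.symm, h.1⟩
  · intros; rfl

/-- Coning is a contracting homotopy of the augmented complex of the full simplex. -/
lemma simplexBoundary_cone (v : V) (f : Finset V → k) :
    simplexBoundary (cone v f) + cone v (simplexBoundary f) = f := by
  ext A
  simp only [simplexBoundary, cone, Pi.add_apply]
  by_cases hv : v ∈ A
  · rw [if_pos hv]
    have hc : (A.erase v)ᶜ = insert v Aᶜ := by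
      ext x; by_cases h : x = v <;> simp [h]
    rw [hc, Finset.sum_insert (by simpa using hv), Finset.insert_erase hv, vertexSign_erase_self,
      mul_add, ← mul_assoc, vertexSign_mul_self, one_mul, Finset.mul_sum, add_left_comm,
      ← Finset.sum_add_distrib, Finset.sum_eq_zero, add_zero]
    intro w hw
    have hw : w ∉ A := by simpa using hw
    have hne : v ≠ w := fun h => hw (h ▸ hv)
    have hw' : w ∉ A.erase v := fun h => hw (Finset.mem_of_mem_erase h)
    rw [if_pos (Finset.mem_insert_of_mem hv), Finset.erase_insert_of_ne hne.symm]
    have := vertexSign_anticomm (k := k) hne (Finset.notMem_erase v A) hw'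
    rw [Finset.insert_erase hv, vertexSign_erase_self] at this
    have h2 : vertexSign k v (insert w (A.erase v)) = vertexSign k v (insert w A) := by
      rw [← vertexSign_erase_self v (insert w A), Finset.erase_insert_of_ne hne.symm]
    rw [h2] at this
    have h3 := vertexSign_mul_self (k := k) v (insert w A)
    have h4 := vertexSign_mul_self (k := k) v A
    -- Anticommutation, multiplied by both signs of `v`, becomes the required cancellation once
    -- squares of signs are replaced by 1.
    linear_combination (vertexSign k v A * vertexSign k v (insert w A)) *
      f (insert w (A.erase v)) * this
        - vertexSign k v A * vertexSign k w (A.erase v) * f (insert w (A.erase v)) * h3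
        - vertexSign k w A * vertexSign k v (insert w A) * f (insert w (A.erase v)) * h4
  · rw [if_neg hv, add_zero, Finset.sum_eq_single v]
    · rw [if_pos (Finset.mem_insert_self v A), Finset.erase_insert hv, vertexSign_insert_self,
        ← mul_assoc, vertexSign_mul_self, one_mul]
    · intro w _ hwv
      rw [if_neg (by simp [hv, hwv.symm]), mul_zero]
    · intro h
      exact absurd (by simpa using hv) h

variable (k) in
/-- A family of finite sets is acyclic over `k` if every cycle supported on it bounds a chain
supported on it (augmentation included, so that the empty set counts as a face). -/
def Acyclic (K : Set (Finset V)) : Prop :=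
  ∀ z : Finset V → k, Function.support z ⊆ K → simplexBoundary z = 0 →
    ∃ u : Finset V → k, Function.support u ⊆ K ∧ simplexBoundary u = z

lemma simplexBoundary_support {K : Set (Finset V)} (hK : IsLowerSet K) {f : Finset V → k}
    (hf : Function.support f ⊆ K) : Function.support (simplexBoundary f) ⊆ K := by
  intro A hA
  obtain ⟨v, -, hv⟩ := Finset.exists_ne_zero_of_sum_ne_zero hA
  exact hK (Finset.subset_insert v A) (hf (right_ne_zero_of_mul hv))

/-- A simplex is a cone over any of its vertices. For empty `W` the empty face would be a cycle that
bounds nothing (over a nontrivial ring). -/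
lemma acyclic_Iic {W : Finset V} (hW : W.Nonempty) : Acyclic k (Set.Iic W) := by
  obtain ⟨v, hv⟩ := hW
  intro z hz hz'
  refine ⟨cone v z, fun A hA => ?_, ?_⟩
  · by_cases h : v ∈ A
    · have hA' : cone v z A ≠ 0 := hA
      rw [cone, if_pos h] at hA'
      have h2 : A.erase v ⊆ W := hz (right_ne_zero_of_mul hA')
      intro x hx
      by_cases hxv : x = v
      · exact hxv ▸ hv
      · exact h2 (Finset.mem_erase.2 ⟨hxv, hx⟩)
    · exact absurd (if_neg h) hA
  · have h := simplexBoundary_cone v z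
    have h0 : cone v (0 : Finset V → k) = 0 := by ext A; simp [cone]
    rwa [hz', h0, add_zero] at h

/-- Mayer–Vietoris by hand: split the cycle as z₁ + z₂ with parts in `K` and `L`. Then ∂z₁ = -∂z₂ is
a cycle in `K ∩ L`, hence equals ∂u there, and z₁ - u and z₂ + u are cycles that bound in `K` and
`L`. -/
lemma Acyclic.union {K L : Set (Finset V)} (hK : Acyclic k K) (hL : Acyclic k L)
    (hKL : Acyclic k (K ∩ L)) (hK' : IsLowerSet K) (hL' : IsLowerSet L) :
    Acyclic k (K ∪ L) := by
  classical
  intro z hz hz'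
  set z₁ : Finset V → k := K.indicator z with hz₁
  set z₂ : Finset V → k := z - z₁ with hz₂
  have h₁ : Function.support z₁ ⊆ K := Set.support_indicator_subset
  have h₂ : Function.support z₂ ⊆ L := by
    intro A hA
    have hA' : z A - K.indicator z A ≠ 0 := hA
    by_cases h : A ∈ K
    · simp [h] at hA'
    · rw [Set.indicator_of_notMem h, sub_zero] at hA'
      exact (hz hA').resolve_left h
  have hb : simplexBoundary z₁ = -simplexBoundary z₂ := by
    rw [hz₂, simplexBoundary_sub, hz', zero_sub, neg_neg]
  obtain ⟨u, hu, hu'⟩ := hKL (simplexBoundary z₁)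
    (Set.subset_inter (simplexBoundary_support hK' h₁)
      (by rw [hb, Function.support_neg]; exact simplexBoundary_support hL' h₂))
    (simplexBoundary_simplexBoundary _)
  obtain ⟨a, ha, ha'⟩ := hK (z₁ - u)
    ((Function.support_sub _ _).trans (Set.union_subset h₁ (hu.trans Set.inter_subset_left)))
    (by rw [simplexBoundary_sub, hu', sub_self])
  obtain ⟨b, hb, hb'⟩ := hL (z₂ + u)
    ((Function.support_add _ _).trans (Set.union_subset h₂ (hu.trans Set.inter_subset_right)))
    (by rw [simplexBoundary_add, hu', hb, add_neg_cancel])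
  refine ⟨a + b, (Function.support_add _ _).trans (Set.union_subset_union ha hb), ?_⟩
  rw [simplexBoundary_add, ha', hb', hz₂]
  abel

end Chains

/-! ### Leaves and linked families of facets -/

section TreeAcyclic

variable {V : Type*}

/-- The family of all subsets of members of `𝓕`. -/
def generated (𝓕 : Finset (Finset V)) : Set (Finset V) :=
  {A | ∃ F ∈ 𝓕, A ⊆ F}

lemma isLowerSet_generated (𝓕 : Finset (Finset V)) : IsLowerSet (generated 𝓕) :=
  fun _ _ hBA ⟨F, hF, hA⟩ => ⟨F, hF, hBA.trans hA⟩

/-- The simplicial complex of the nonempty subsets of members of `𝓕`. -/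
def generatedComplex (𝓕 : Finset (Finset V)) : PreAbstractSimplicialComplex V where
  faces := {A | A.Nonempty ∧ A ∈ generated 𝓕}
  isRelLowerSet_faces := fun _ hA =>
    ⟨hA.1, fun _ hBA hB => ⟨hB, isLowerSet_generated 𝓕 hBA hA.2⟩⟩

lemma facets_generatedComplex {𝓕 : Finset (Finset V)} (hne : ∀ F ∈ 𝓕, F.Nonempty)
    (hanti : IsAntichain (· ⊆ ·) (𝓕 : Set (Finset V))) :
    facets (generatedComplex 𝓕) = 𝓕 := by
  ext F
  constructor
  · rintro ⟨⟨hF, G, hG, hFG⟩, hmax⟩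
    have hGF : G ⊆ F := hmax ⟨hne G hG, G, hG, subset_rfl⟩ hFG
    rwa [subset_antisymm hFG hGF]
  · intro hF
    refine ⟨⟨hne F hF, F, hF, subset_rfl⟩, ?_⟩
    rintro A ⟨-, G, hG, hAG⟩ hFA
    have hFA : F ⊆ A := hFA
    have : F = G := hanti.eq hF hG (hFA.trans hAG)
    exact this ▸ hAG

lemma facet_nonempty {Δ : AbstractSimplicialComplex V} {F : Finset V}
    (hF : F ∈ facets Δ.toPreAbstractSimplicialComplex) : F.Nonempty :=
  (Δ.isRelLowerSet_faces hF.1).1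

lemma antichain_facets (K : PreAbstractSimplicialComplex V) :
    IsAntichain (· ⊆ ·) (facets K) :=
  fun _ hF _ hG hne hFG => hne (hF.eq_of_le hG.1 hFG)

lemma exists_facet_superset [Finite V] (K : PreAbstractSimplicialComplex V) {A : Finset V}
    (hA : A ∈ K) : ∃ F ∈ facets K, A ⊆ F := by
  obtain ⟨F, hAF, hF⟩ := (Set.toFinite {G : Finset V | G ∈ K}).exists_le_maximal hA
  exact ⟨F, hF, hAF⟩

/-- The faces of a complex, the empty face included. -/
def augmentedFaces (Δ : AbstractSimplicialComplex V) : Set (Finset V) :=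
  {A | A = ∅ ∨ A ∈ Δ}

lemma isLowerSet_augmentedFaces (Δ : AbstractSimplicialComplex V) :
    IsLowerSet (augmentedFaces Δ) := by
  rintro A B hBA hA
  have hBA : B ⊆ A := hBA
  rcases B.eq_empty_or_nonempty with h | h
  · exact Or.inl h
  · rcases hA with rfl | hA
    · exact Or.inl (Finset.subset_empty.1 hBA)
    · exact Or.inr ((Δ.isRelLowerSet_faces hA).2 hBA h)

variable [DecidableEq V]

/-- A family of finite sets is linked if it is not the union of two nonempty parts without
intersecting members. -/
def Linked (𝓕 : Finset (Finset V)) : Prop :=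
  ∀ 𝓐 ⊆ 𝓕, 𝓐.Nonempty → 𝓐 ≠ 𝓕 → ∃ A ∈ 𝓐, ∃ B ∈ 𝓕 \ 𝓐, (A ∩ B).Nonempty

lemma Linked.inter_nonempty {𝓕 : Finset (Finset V)} (h : Linked 𝓕) {F G : Finset V}
    (hF : F ∈ 𝓕) (hG : G ∈ 𝓕) (hGF : G ≠ F) (hleaf : ∀ H ∈ 𝓕, H ≠ F → F ∩ H ⊆ G) :
    (F ∩ G).Nonempty := by
  obtain ⟨A, hA, B, hB, x, hx⟩ := h {F} (by simpa using hF) (by simp) (by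
    rintro rfl
    exact hGF (Finset.mem_singleton.1 hG))
  simp only [Finset.mem_singleton] at hA
  subst hA
  simp only [Finset.mem_sdiff, Finset.mem_singleton] at hB
  exact ⟨x, Finset.mem_inter.2 ⟨(Finset.mem_inter.1 hx).1, hleaf B hB.1 hB.2 hx⟩⟩

/-- Whatever `F` shares with another member lies in `G`, so any link through `F` can be rerouted
through `G`. Accordingly `F` is put on the same side of the partition as `G`. -/
lemma Linked.erase {𝓕 : Finset (Finset V)} (h : Linked 𝓕) {F G : Finset V}
    (hF : F ∈ 𝓕) (hG : G ∈ 𝓕) (hGF : G ≠ F) (hleaf : ∀ H ∈ 𝓕, H ≠ F → F ∩ H ⊆ G) :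
    Linked (𝓕.erase F) := by
  intro 𝓐 h𝓐 hne hne'
  have hsub : 𝓐 ⊆ 𝓕 := h𝓐.trans (Finset.erase_subset _ _)
  have hF𝓐 : F ∉ 𝓐 := fun hh => Finset.notMem_erase F 𝓕 (h𝓐 hh)
  by_cases hG𝓐 : G ∈ 𝓐
  · obtain ⟨A, hA, B, hB, hAB⟩ := h (insert F 𝓐) (Finset.insert_subset hF hsub) (by simp) (by
      rintro rfl
      exact hne' (Finset.erase_insert hF𝓐).symm)
    simp only [Finset.mem_sdiff, Finset.mem_insert, not_or] at hB
    have hB' : B ∈ 𝓕.erase F \ 𝓐 := by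
      simp only [Finset.mem_sdiff, Finset.mem_erase]
      exact ⟨⟨hB.2.1, hB.1⟩, hB.2.2⟩
    rcases Finset.mem_insert.1 hA with rfl | hA
    · exact ⟨G, hG𝓐, B, hB', hAB.mono
        (Finset.subset_inter (hleaf B hB.1 hB.2.1) Finset.inter_subset_right)⟩
    · exact ⟨A, hA, B, hB', hAB⟩
  · obtain ⟨A, hA, B, hB, hAB⟩ := h 𝓐 hsub hne (by rintro rfl; exact hF𝓐 hF)
    simp only [Finset.mem_sdiff] at hB
    by_cases hBF : B = F
    · subst hBF
      refine ⟨A, hA, G, by simp [hGF, hG, hG𝓐], hAB.mono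
        (Finset.subset_inter Finset.inter_subset_left ?_)⟩
      rw [Finset.inter_comm]
      exact hleaf A (hsub hA) (fun e => hF𝓐 (e ▸ hA))
    · exact ⟨A, hA, B, by simp [hBF, hB.1, hB.2], hAB⟩

lemma generated_eq_erase_union {𝓕 : Finset (Finset V)} {F : Finset V} (hF : F ∈ 𝓕) :
    generated 𝓕 = generated (𝓕.erase F) ∪ Set.Iic F := by
  ext A
  constructor
  · rintro ⟨H, hH, hA⟩
    by_cases hHF : H = F
    · exact Or.inr (hHF ▸ hA)
    · exact Or.inl ⟨H, Finset.mem_erase.2 ⟨hHF, hH⟩, hA⟩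
  · rintro (⟨H, hH, hA⟩ | hA)
    · exact ⟨H, Finset.mem_of_mem_erase hH, hA⟩
    · exact ⟨F, hF, hA⟩

lemma generated_erase_inter {𝓕 : Finset (Finset V)} {F G : Finset V}
    (hG : G ∈ 𝓕) (hGF : G ≠ F) (hleaf : ∀ H ∈ 𝓕, H ≠ F → F ∩ H ⊆ G) :
    generated (𝓕.erase F) ∩ Set.Iic F = Set.Iic (F ∩ G) := by
  ext A
  constructor
  · rintro ⟨⟨H, hH, hA⟩, hAF⟩
    obtain ⟨h1, h2⟩ := Finset.mem_erase.1 hH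
    exact Finset.subset_inter hAF ((Finset.subset_inter hAF hA).trans (hleaf H h2 h1))
  · intro hA
    exact ⟨⟨G, Finset.mem_erase.2 ⟨hGF, hG⟩, hA.trans Finset.inter_subset_right⟩,
      hA.trans Finset.inter_subset_left⟩

/-- Two vertices of a tree are joined by a path of edges, so its facets are linked. -/
lemma IsTree.linked [Finite V] {Δ : AbstractSimplicialComplex V} (hΔ : IsTree Δ)
    {𝓕 : Finset (Finset V)} (h𝓕 : (𝓕 : Set (Finset V)) = facets Δ.toPreAbstractSimplicialComplex) :
    Linked 𝓕 := by
  have hmem : ∀ F, F ∈ 𝓕 ↔ F ∈ facets Δ.toPreAbstractSimplicialComplex := fun F => by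
    rw [← h𝓕, Finset.mem_coe]
  intro 𝓐 h𝓐 ⟨A₀, hA₀⟩ hne
  by_contra! hcon
  obtain ⟨B, hB, hB'⟩ := Finset.exists_of_ssubset (h𝓐.ssubset_of_ne hne)
  obtain ⟨a, ha⟩ := facet_nonempty ((hmem _).1 (h𝓐 hA₀))
  obtain ⟨b, hb⟩ := facet_nonempty ((hmem _).1 hB)
  -- A facet containing the next edge of a path meets the current member of `𝓐`, so it belongs to
  -- `𝓐` as well.
  have key : ∀ w, (edgeGraph Δ).Reachable a w → ∃ A ∈ 𝓐, w ∈ A := by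
    rintro w ⟨p⟩
    have : ∀ {u w : V} (p : (edgeGraph Δ).Walk u w), (∃ A ∈ 𝓐, u ∈ A) → ∃ A ∈ 𝓐, w ∈ A := by
      intro u w p
      induction p with
      | nil => exact id
      | cons hadj _ ih =>
        rintro ⟨A, hA, hu⟩
        apply ih
        obtain ⟨H, hH, hsub⟩ := exists_facet_superset _ hadj.2
        refine ⟨H, ?_, hsub (by simp)⟩
        by_contra hH'
        have := hcon A hA H (by simp [hH', hmem, hH])
        exact Finset.notMem_empty _ (this ▸ Finset.mem_inter.2 ⟨hu, hsub (by simp)⟩)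
    exact this p ⟨A₀, hA₀, ha⟩
  obtain ⟨A, hA, hbA⟩ := key b (hΔ.1.preconnected a b)
  have := hcon A hA B (by simp [hB, hB'])
  exact Finset.notMem_empty _ (this ▸ Finset.mem_inter.2 ⟨hbA, hb⟩)

end TreeAcyclic

/-! ### Acyclicity of trees, and trees are not boundaries of simplices -/

section TreeAcyclic

variable {V : Type*} [LinearOrder V]

/-- Induction on the family: a leaf `F` meets the complex of the remaining facets in the simplex on
`F ∩ G`. Linkedness passes to the remaining family and keeps `F ∩ G` nonempty, as Mayer–Vietoris
requires. -/
lemma IsTree.acyclic_generated [Fintype V] (k : Type*) [CommRing k]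
    {Δ : AbstractSimplicialComplex V} (hΔ : IsTree Δ) (𝓕 : Finset (Finset V))
    (h𝓕 : (𝓕 : Set (Finset V)) ⊆ facets Δ.toPreAbstractSimplicialComplex) (hne : 𝓕.Nonempty)
    (hlink : Linked 𝓕) : Acyclic k (generated 𝓕) := by
  induction 𝓕 using Finset.strongInduction with
  | H 𝓕 ih =>
    -- Facets of Δ are pairwise incomparable, so the subcollection generated by `𝓕` has exactly `𝓕`
    -- as its facets and the leaf lies in `𝓕`.
    have hfac : facets (generatedComplex 𝓕) = 𝓕 :=
      facets_generatedComplex (fun F hF => facet_nonempty (h𝓕 hF))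
        ((antichain_facets _).subset h𝓕)
    obtain ⟨F₀, hF₀⟩ := hne
    obtain ⟨F, hF, hF'⟩ := hΔ.2 (generatedComplex 𝓕)
      ⟨F₀, facet_nonempty (h𝓕 hF₀), F₀, hF₀, subset_rfl⟩ (by rw [IsSubcollection, hfac]; exact h𝓕)
    rw [hfac] at hF hF'
    have hF : F ∈ 𝓕 := hF
    have hFne : F.Nonempty := facet_nonempty (h𝓕 hF)
    rcases hF' with h | ⟨G, hG, hGF, hleaf⟩
    · have : generated 𝓕 = Set.Iic F := by
        ext A
        exact ⟨fun ⟨H, hH, hA⟩ => h H hH ▸ hA, fun hA => ⟨F, hF, hA⟩⟩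
      rw [this]
      exact acyclic_Iic hFne
    · have hG : G ∈ 𝓕 := hG
      rw [generated_eq_erase_union hF]
      refine Acyclic.union (ih _ (Finset.erase_ssubset hF) ?_ ⟨G, Finset.mem_erase.2 ⟨hGF, hG⟩⟩
        (hlink.erase hF hG hGF hleaf)) (acyclic_Iic hFne) ?_ (isLowerSet_generated _)
        (isLowerSet_Iic _)
      · exact (Finset.coe_subset.2 (Finset.erase_subset _ _)).trans h𝓕
      · rw [generated_erase_inter hG hGF hleaf]
        exact acyclic_Iic (hlink.inter_nonempty hF hG hGF hleaf)

theorem IsTree.acyclic_augmentedFaces [Fintype V] (k : Type*) [CommRing k]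
    {Δ : AbstractSimplicialComplex V} (hΔ : IsTree Δ) : Acyclic k (augmentedFaces Δ) := by
  classical
  set 𝓕 := (Set.toFinite (facets Δ.toPreAbstractSimplicialComplex)).toFinset with h
  have h𝓕 : (𝓕 : Set (Finset V)) = facets Δ.toPreAbstractSimplicialComplex := by simp [h]
  have hmem : ∀ F, F ∈ 𝓕 ↔ F ∈ facets Δ.toPreAbstractSimplicialComplex := fun F => by
    rw [← h𝓕, Finset.mem_coe]
  obtain ⟨v⟩ := hΔ.1.nonempty
  obtain ⟨F₀, hF₀, -⟩ := exists_facet_superset Δ.toPreAbstractSimplicialComplex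
    (Δ.singleton_mem v)
  have : augmentedFaces Δ = generated 𝓕 := by
    ext A
    constructor
    · rintro (rfl | hA)
      · exact ⟨F₀, (hmem _).2 hF₀, Finset.empty_subset _⟩
      · obtain ⟨F, hF, hAF⟩ := exists_facet_superset Δ.toPreAbstractSimplicialComplex hA
        exact ⟨F, (hmem _).2 hF, hAF⟩
    · rintro ⟨F, hF, hAF⟩
      exact isLowerSet_augmentedFaces Δ hAF (Or.inr ((hmem _).1 hF).1)
  rw [this]
  exact hΔ.acyclic_generated k 𝓕 h𝓕.subset ⟨F₀, (hmem _).2 hF₀⟩ (hΔ.linked h𝓕)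

/-- A tree is not the boundary of a simplex: a non-face is never the only one. -/
theorem IsTree.exists_nonface_ne [Fintype V] {Δ : AbstractSimplicialComplex V} (hΔ : IsTree Δ)
    {B : Finset V} (hB : B ∉ augmentedFaces Δ) : ∃ C, C ∉ augmentedFaces Δ ∧ C ≠ B := by
  by_contra! hcon
  -- Non-faces are closed under supersets, so a sole non-face must be the whole vertex set.
  have hB' : Finset.univ = B := hcon _ fun h =>
    hB (isLowerSet_augmentedFaces Δ (Finset.subset_univ B) h)
  subst hB'
  obtain ⟨v₀⟩ := hΔ.1.nonempty
  obtain ⟨F, hF, hleaf⟩ := hΔ.2 Δ.toPreAbstractSimplicialComplex ⟨{v₀}, Δ.singleton_mem v₀⟩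
    subset_rfl
  rcases hleaf with h | ⟨G, hG, hGF, hleaf⟩
  · have : F = Finset.univ := by
      refine Finset.eq_univ_iff_forall.2 fun v => ?_
      obtain ⟨H, hH, hv⟩ := exists_facet_superset _ (Δ.singleton_mem v)
      exact h H hH ▸ hv (Finset.mem_singleton_self v)
    exact hB (Or.inr (this ▸ hF.1))
  · obtain ⟨v, hvF, hvG⟩ := Finset.not_subset.1
      (fun h => hGF (antichain_facets _ |>.eq hF hG h).symm)
    obtain ⟨g, hgG, hgF⟩ := Finset.not_subset.1
      (fun h => hGF (antichain_facets _ |>.eq hG hF h))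
    -- A vertex of the leaf outside `G` lies in no other facet.
    have honly : ∀ A, A ∈ Δ → v ∈ A → A ⊆ F := by
      intro A hA hv
      obtain ⟨H, hH, hAH⟩ := exists_facet_superset Δ.toPreAbstractSimplicialComplex hA
      by_cases hHF : H = F
      · exact hHF ▸ hAH
      · exact absurd (hleaf H hH hHF (Finset.mem_inter.2 ⟨hvF, hAH hv⟩)) hvG
    have hvg : v ≠ g := fun h => hgF (h ▸ hvF)
    have : Nontrivial V := ⟨v, g, hvg⟩
    obtain ⟨u, hu⟩ := hΔ.1.preconnected.exists_adj_of_nontrivial v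
    have huF : u ∈ F := honly _ hu.2 (by simp) (by simp)
    -- The pair is a non-face, hence the only one. With just these two vertices, `v` has no possible
    -- neighbour, against connectedness.
    have hpair : ({v, g} : Finset V) = Finset.univ := by
      apply hcon
      rintro (h | h)
      · simp at h
      · exact hgF (honly _ h (by simp) (by simp))
    have : u ∈ ({v, g} : Finset V) := hpair ▸ Finset.mem_univ u
    simp only [Finset.mem_insert, Finset.mem_singleton] at this
    rcases this with rfl | rfl
    · exact hu.1 rfl
    · exact hgF huF

end TreeAcyclic

/-! ### Decomposition of labelled chains by multidegree -/

section LabelledChains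

lemma faceLabel_mono {V σ : Type*} (m : V → (σ →₀ ℕ)) {A B : Finset V} (h : A ⊆ B) :
    faceLabel m A ≤ faceLabel m B :=
  Finset.sup_mono h

variable {V σ k : Type*} [Field k] (m : V → (σ →₀ ℕ))

open Classical in
/-- The component of multidegree `b` of a labelled chain. -/
noncomputable def component (b : σ →₀ ℕ) (f : Finset V → MvPolynomial σ k) (A : Finset V) : k :=
  if faceLabel m A ≤ b then coeff (b - faceLabel m A) (f A) else 0

open Classical in
/-- The homogeneous labelled chain of multidegree `b` with given coefficients. -/
noncomputable def homogenize (b : σ →₀ ℕ) (g : Finset V → k) (A : Finset V) :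
    MvPolynomial σ k :=
  if faceLabel m A ≤ b then monomial (b - faceLabel m A) (g A) else 0

lemma exists_sum_homogenize_component [Fintype V] (f : Finset V → MvPolynomial σ k) :
    ∃ s : Finset (σ →₀ ℕ), ∑ b ∈ s, homogenize m b (component m b f) = f := by
  classical
  -- A monomial of exponent c in the coefficient of `A` has multidegree c + `faceLabel m A`.
  refine ⟨Finset.univ.biUnion fun A => (f A).support.image (· + faceLabel m A), ?_⟩
  ext A c
  simp only [Finset.sum_apply, coeff_sum]
  rw [Finset.sum_eq_single (c + faceLabel m A)]
  · simp [homogenize, component]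
  · intro b _ hb
    simp only [homogenize]
    split_ifs with h
    · rw [coeff_monomial, if_neg]
      rintro rfl
      exact hb (tsub_add_cancel_of_le h).symm
    · simp
  · intro h
    have : coeff c (f A) = 0 := by
      by_contra h0
      exact h (Finset.mem_biUnion.2 ⟨A, Finset.mem_univ A, Finset.mem_image_of_mem _
        (mem_support_iff.2 h0)⟩)
    simp [homogenize, component, this]

variable [LinearOrder V] [Fintype V]

/-- The boundary of the full simplex labelled by the monomials with exponents `m`, where a chain
is given by its coefficients. -/
noncomputable def labelledBoundary (f : Finset V → MvPolynomial σ k) (A : Finset V) :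
    MvPolynomial σ k :=
  ∑ v ∈ Aᶜ, monomial (faceLabel m (insert v A) - faceLabel m A) (vertexSign k v A) *
    f (insert v A)

lemma labelledBoundary_sum {ι : Type*} (s : Finset ι) (f : ι → Finset V → MvPolynomial σ k) :
    labelledBoundary m (∑ b ∈ s, f b) = ∑ b ∈ s, labelledBoundary m (f b) := by
  ext1 A
  simp only [labelledBoundary, Finset.sum_apply, Finset.mul_sum]
  exact Finset.sum_comm

lemma component_labelledBoundary (b : σ →₀ ℕ) (f : Finset V → MvPolynomial σ k) :
    component m b (labelledBoundary m f) = simplexBoundary (component m b f) := by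
  ext A
  simp only [component, labelledBoundary, simplexBoundary, coeff_sum, coeff_monomial_mul']
  split_ifs with hA
  · refine Finset.sum_congr rfl fun v _ => ?_
    have hle := faceLabel_mono m (Finset.subset_insert v A)
    by_cases h : faceLabel m (insert v A) ≤ b
    · rw [if_pos h, if_pos (tsub_le_tsub_right h _), tsub_tsub_tsub_cancel_right hle]
    · rw [if_neg h, if_neg (by rwa [tsub_le_tsub_iff_right hA]), mul_zero]
  · refine (Finset.sum_eq_zero fun v _ => ?_).symm
    rw [if_neg fun h => hA ((faceLabel_mono m (Finset.subset_insert v A)).trans h), mul_zero]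

/-- The support condition is essential: `homogenize` discards coefficients on sets whose label does
not divide x^b, whereas `simplexBoundary` still sees them. -/
lemma labelledBoundary_homogenize {b : σ →₀ ℕ} {g : Finset V → k}
    (hg : ∀ A, g A ≠ 0 → faceLabel m A ≤ b) :
    labelledBoundary m (homogenize m b g) = homogenize m b (simplexBoundary g) := by
  ext1 A
  simp only [homogenize, labelledBoundary, simplexBoundary]
  split_ifs with hA
  · rw [map_sum]
    refine Finset.sum_congr rfl fun v _ => ?_
    have hle := faceLabel_mono m (Finset.subset_insert v A)
    split_ifs with h
    · rw [monomial_mul, add_comm, tsub_add_tsub_cancel h hle]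
    · rw [not_imp_comm.1 (hg _) h]; simp
  · refine Finset.sum_eq_zero fun v _ => ?_
    rw [if_neg fun h => hA ((faceLabel_mono m (Finset.subset_insert v A)).trans h), mul_zero]

lemma labelledBoundary_labelledBoundary (f : Finset V → MvPolynomial σ k) :
    labelledBoundary m (labelledBoundary m f) = 0 := by
  obtain ⟨s, hs⟩ := exists_sum_homogenize_component m (labelledBoundary m (labelledBoundary m f))
  rw [← hs]
  refine Finset.sum_eq_zero fun b _ => ?_
  rw [component_labelledBoundary, component_labelledBoundary, simplexBoundary_simplexBoundary]
  ext1 A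
  simp [homogenize]

/-- The boundary lowers cardinality by one, so only the part of `u` in cardinality `i + 1`
contributes to `z`. -/
lemma exists_simplexBoundary_eq_of_card {K : Set (Finset V)} {z u : Finset V → k} {i : ℕ}
    (hz : ∀ A, z A ≠ 0 → A.card = i) (hu : Function.support u ⊆ K) (huz : simplexBoundary u = z) :
    ∃ u', (∀ A, u' A ≠ 0 → A ∈ K ∧ A.card = i + 1) ∧ simplexBoundary u' = z := by
  classical
  refine ⟨fun A => if A.card = i + 1 then u A else 0, fun A hA => ?_, ?_⟩
  · dsimp only at hA
    split_ifs at hA with h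
    · exact ⟨hu hA, h⟩
    · exact absurd rfl hA
  · ext A
    by_cases hA : A.card = i
    · rw [← huz]
      refine Finset.sum_congr rfl fun v hv => ?_
      dsimp only
      rw [if_pos (by rw [Finset.card_insert_of_notMem (Finset.mem_compl.1 hv), hA])]
    · rw [not_imp_comm.1 (hz A) hA]
      refine Finset.sum_eq_zero fun v hv => ?_
      dsimp only
      rw [if_neg (by rw [Finset.card_insert_of_notMem (Finset.mem_compl.1 hv)]; omega), mul_zero]

/-- The labelled chain complex of `K` is exact in positive degrees if the subfamilies of `K` with
bounded labels are acyclic or have at most the empty face. -/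
theorem exists_labelledBoundary_eq {K : Set (Finset V)}
    (hK : ∀ b, K ∩ {A | faceLabel m A ≤ b} ⊆ {∅} ∨ Acyclic k (K ∩ {A | faceLabel m A ≤ b}))
    {i : ℕ} {z : Finset V → MvPolynomial σ k} (hz : ∀ A, z A ≠ 0 → A ∈ K ∧ A.card = i + 1)
    (hz' : labelledBoundary m z = 0) :
    ∃ u : Finset V → MvPolynomial σ k, (∀ A, u A ≠ 0 → A ∈ K ∧ A.card = i + 1 + 1) ∧
      labelledBoundary m u = z := by
  have key : ∀ b, ∃ u : Finset V → k,
      (∀ A, u A ≠ 0 → A ∈ K ∩ {A | faceLabel m A ≤ b} ∧ A.card = i + 1 + 1) ∧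
      simplexBoundary u = component m b z := by
    intro b
    have hc : ∀ A, component m b z A ≠ 0 → A ∈ K ∩ {A | faceLabel m A ≤ b} ∧ A.card = i + 1 := by
      intro A hA
      simp only [component] at hA
      split_ifs at hA with h
      · have h0 : z A ≠ 0 := by rintro h0; simp [h0] at hA
        exact ⟨⟨(hz A h0).1, h⟩, (hz A h0).2⟩
      · exact absurd rfl hA
    rcases hK b with h | h
    -- Here only the empty face is available, but `z` lives on sets of cardinality `i + 1`, so its
    -- component vanishes.
    · refine ⟨0, fun A hA => absurd rfl hA, ?_⟩
      rw [simplexBoundary_zero]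
      ext A
      by_contra h0
      obtain ⟨h1, h2⟩ := hc A (Ne.symm h0)
      rw [Set.mem_singleton_iff.1 (h h1)] at h2
      simp at h2
    · obtain ⟨u, hu, hu'⟩ := h (component m b z) (fun A hA => (hc A hA).1) (by
        rw [← component_labelledBoundary, hz']
        ext A
        simp [component])
      exact exists_simplexBoundary_eq_of_card (fun A hA => (hc A hA).2) hu hu'
  choose u hu hu' using key
  obtain ⟨s, hs⟩ := exists_sum_homogenize_component m z
  refine ⟨∑ b ∈ s, homogenize m b (u b), fun A hA => ?_, ?_⟩
  · rw [Finset.sum_apply] at hA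
    obtain ⟨b, -, hb⟩ := Finset.exists_ne_zero_of_sum_ne_zero hA
    have h0 : u b A ≠ 0 := by rintro h0; simp [homogenize, h0] at hb
    exact ⟨(hu b A h0).1.1, (hu b A h0).2⟩
  · rw [labelledBoundary_sum]
    conv_rhs => rw [← hs]
    refine Finset.sum_congr rfl fun b _ => ?_
    rw [labelledBoundary_homogenize m fun A hA => (hu b A hA).1.2, hu']

end LabelledChains

/-! ### From acyclic subcomplexes to a minimal free resolution -/

section Resolution

variable {V : Type*} {Δ : AbstractSimplicialComplex V} {σ k : Type*} [Field k]

/-- The ideal generated by the monomials with exponents `m v`. -/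
noncomputable def labelIdeal (k : Type*) [Field k] (m : V → (σ →₀ ℕ)) :
    Ideal (MvPolynomial σ k) :=
  Ideal.span ((fun a => monomial a (1 : k)) '' Set.range m)

lemma monomial_mem_labelIdeal_iff (m : V → (σ →₀ ℕ)) (b : σ →₀ ℕ) :
    monomial b (1 : k) ∈ labelIdeal k m ↔ ∃ v, m v ≤ b := by
  classical
  rw [labelIdeal, mem_ideal_span_monomial_image, support_monomial, if_neg one_ne_zero]
  simp

lemma monomial_mem_labelIdeal (m : V → (σ →₀ ℕ)) (v : V) (c : k) :
    monomial (m v) c ∈ labelIdeal k m := by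
  have := Ideal.mul_mem_left _ (C c) ((monomial_mem_labelIdeal_iff (k := k) m (m v)).2 ⟨v, le_rfl⟩)
  rwa [C_mul_monomial, mul_one] at this

/-- The empty face. -/
def emptyFace (Δ : AbstractSimplicialComplex V) : FaceOfCard Δ 0 :=
  ⟨∅, rfl, Or.inl rfl⟩

lemma eq_emptyFace (F : FaceOfCard Δ 0) : F = emptyFace Δ :=
  Subtype.ext (Finset.card_eq_zero.1 F.2.1)

lemma eq_single_emptyFace (f : chains Δ k σ 0) :
    f = Finsupp.single (emptyFace Δ) (f (emptyFace Δ)) := by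
  ext1 F
  rw [eq_emptyFace F, Finsupp.single_eq_same]

lemma augmentation_apply (I : Ideal (MvPolynomial σ k)) (f : chains Δ k σ 0) :
    augmentation Δ k I f = Ideal.Quotient.mk I (f (emptyFace Δ)) := by
  conv_lhs => rw [eq_single_emptyFace f]
  rw [augmentation, Finsupp.linearCombination_single, ← map_one (Ideal.Quotient.mk I),
    ← Ideal.Quotient.mk_eq_mk, ← Ideal.Quotient.mk_eq_mk, ← Submodule.Quotient.mk_smul,
    smul_eq_mul, mul_one]

variable [LinearOrder V]

open Classical in
/-- The extension by zero of a labelled chain of `Δ` to the full simplex. -/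
noncomputable def extendChain {i : ℕ} (f : chains Δ k σ i) (A : Finset V) : MvPolynomial σ k :=
  if h : A.card = i ∧ (A = ∅ ∨ A ∈ Δ) then f ⟨A, h⟩ else 0

lemma extendChain_coe {i : ℕ} (f : chains Δ k σ i) (F : FaceOfCard Δ i) :
    extendChain f F.1 = f F :=
  dif_pos F.2

lemma extendChain_injective {i : ℕ} :
    Function.Injective (extendChain : chains Δ k σ i → Finset V → MvPolynomial σ k) := by
  intro f g h
  ext1 F
  rw [← extendChain_coe, h, extendChain_coe]

lemma extendChain_zero {i : ℕ} : extendChain (0 : chains Δ k σ i) = 0 := by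
  ext1 A
  simp [extendChain]

lemma extendChain_add {i : ℕ} (f g : chains Δ k σ i) :
    extendChain (f + g) = extendChain f + extendChain g := by
  ext1 A
  by_cases h : A.card = i ∧ (A = ∅ ∨ A ∈ Δ) <;> simp [extendChain, h]

lemma extendChain_single {i : ℕ} (F : FaceOfCard Δ i) (s : MvPolynomial σ k) (A : Finset V) :
    extendChain (Finsupp.single F s) A = if A = F.1 then s else 0 := by
  classical
  split_ifs with h
  · subst h
    rw [extendChain_coe, Finsupp.single_eq_same]
  · unfold extendChain
    split_ifs with h'
    · exact Finsupp.single_eq_of_ne fun e => h (congrArg Subtype.val e)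
    · rfl

lemma extendChain_ne_zero {i : ℕ} {f : chains Δ k σ i} {A : Finset V} (h : extendChain f A ≠ 0) :
    A ∈ augmentedFaces Δ ∧ A.card = i := by
  unfold extendChain at h
  split_ifs at h with h'
  · exact ⟨h'.2, h'.1⟩
  · exact absurd rfl h

lemma exists_extendChain_eq [Finite V] {i : ℕ} {u : Finset V → MvPolynomial σ k}
    (hu : ∀ A, u A ≠ 0 → A ∈ augmentedFaces Δ ∧ A.card = i) :
    ∃ f : chains Δ k σ i, extendChain f = u := by
  refine ⟨Finsupp.equivFunOnFinite.symm fun F => u F.1, ?_⟩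
  ext1 A
  unfold extendChain
  split_ifs with h
  · rfl
  · by_contra h0
    exact h ⟨(hu A (Ne.symm h0)).2, (hu A (Ne.symm h0)).1⟩

lemma boundary_single (m : V → (σ →₀ ℕ)) {i : ℕ} (F : FaceOfCard Δ (i + 1))
    (s : MvPolynomial σ k) :
    boundary Δ k m i (Finsupp.single F s) = ∑ v : F.1, Finsupp.single (F.erase v)
      (monomial (faceLabel m F.1 - faceLabel m (F.1.erase v)) (vertexSign k v.1 F.1) * s) := by
  rw [boundary, Finsupp.linearCombination_single, Finset.smul_sum]
  refine Finset.sum_congr rfl fun v _ => ?_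
  rw [Finsupp.smul_single, smul_eq_mul, mul_comm]
  rfl

/-- This transfers exactness from chains on the full simplex to the modules of the resolution. On a
basis element `F`, both coefficients at `A` come from the vertices `v ∉ A` with `F = insert v A`. -/
lemma extendChain_boundary [Fintype V] (m : V → (σ →₀ ℕ)) {i : ℕ} (f : chains Δ k σ (i + 1)) :
    extendChain (boundary Δ k m i f) = labelledBoundary m (extendChain f) := by
  induction f using Finsupp.induction_linear with
  | zero =>
    ext1 A
    simp [extendChain_zero, labelledBoundary]
  | add f g hf hg =>
    rw [map_add, extendChain_add, hf, hg, extendChain_add]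
    ext1 A
    simp [labelledBoundary, mul_add, Finset.sum_add_distrib]
  | single F s =>
    ext1 A
    have hsum : ∀ g : F.1 → chains Δ k σ i,
        extendChain (∑ v, g v) A = ∑ v, extendChain (g v) A := by
      intro g
      let E : chains Δ k σ i →+ MvPolynomial σ k :=
        { toFun := fun f => extendChain f A
          map_zero' := congrFun extendChain_zero A
          map_add' := fun f g => congrFun (extendChain_add f g) A }
      exact map_sum E g Finset.univ
    rw [boundary_single, hsum]
    simp only [extendChain_single, labelledBoundary, mul_ite, mul_zero]
    have hcoe := Finset.sum_coe_sort F.1 fun v => if A = F.1.erase v then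
      monomial (faceLabel m F.1 - faceLabel m (F.1.erase v)) (vertexSign k v F.1) * s else 0
    refine hcoe.trans ?_
    rw [← Finset.sum_filter, ← Finset.sum_filter]
    refine Finset.sum_congr ?_ fun v hv => ?_
    · ext v
      simp only [Finset.mem_filter, Finset.mem_compl]
      constructor
      · rintro ⟨hv, rfl⟩
        exact ⟨Finset.notMem_erase v F.1, Finset.insert_erase hv⟩
      · rintro ⟨hv, h⟩
        rw [← h]
        exact ⟨Finset.mem_insert_self v A, (Finset.erase_insert hv).symm⟩
    · obtain ⟨hv, h⟩ := Finset.mem_filter.1 hv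
      rw [← h, vertexSign_insert_self, Finset.erase_insert (Finset.mem_compl.1 hv)]

lemma boundary_single_singleton (m : V → (σ →₀ ℕ)) (v : V) (s : MvPolynomial σ k) :
    boundary Δ k m 0 (Finsupp.single ⟨{v}, Finset.card_singleton v, Or.inr (Δ.singleton_mem v)⟩ s) =
      Finsupp.single (emptyFace Δ) (monomial (m v) 1 * s) := by
  rw [boundary_single, Finset.sum_eq_single ⟨v, Finset.mem_singleton_self v⟩]
  · rw [eq_emptyFace (FaceOfCard.erase _ _)]
    have h : vertexSign k v {v} = 1 := by simp [vertexSign, Finset.filter_singleton]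
    simp only [Finset.erase_singleton, h, faceLabel, Finset.sup_singleton, Finset.sup_empty,
      bot_eq_zero, tsub_zero]
  · rintro ⟨w, hw⟩ - hne
    exact absurd (Subtype.ext (Finset.mem_singleton.1 hw)) hne
  · intro h
    exact absurd (Finset.mem_univ _) h

/-- Every singleton is a face, and its boundary is its label times the empty face, so the image of
the first differential is the label ideal. -/
lemma exact_boundary_augmentation (m : V → (σ →₀ ℕ)) :
    Function.Exact (boundary Δ k m 0) (augmentation Δ k (labelIdeal k m)) := by
  intro f
  rw [augmentation_apply, Ideal.Quotient.eq_zero_iff_mem]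
  constructor
  · intro hf
    have hle : labelIdeal k m ≤ (LinearMap.range (boundary Δ k m 0)).comap
        (Finsupp.lsingle (emptyFace Δ)) := by
      refine Ideal.span_le.2 ?_
      rintro _ ⟨_, ⟨v, rfl⟩, rfl⟩
      refine ⟨_, (boundary_single_singleton m v 1).trans ?_⟩
      rw [mul_one, Finsupp.lsingle_apply]
    have := hle hf
    rw [Submodule.mem_comap, Finsupp.lsingle_apply, ← eq_single_emptyFace] at this
    exact this
  · rintro ⟨g, rfl⟩
    induction g using Finsupp.induction_linear with
    | zero => simp
    | add f g hf hg =>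
      rw [map_add, Finsupp.add_apply]
      exact add_mem hf hg
    | single F s =>
      obtain ⟨F, hF, hF'⟩ := F
      obtain ⟨v, rfl⟩ := Finset.card_eq_one.1 hF
      rw [boundary_single_singleton, Finsupp.single_eq_same]
      exact Ideal.mul_mem_right _ _ (monomial_mem_labelIdeal m v 1)

lemma monomial_mem_span_X {a : σ →₀ ℕ} (ha : a ≠ 0) (c : k) :
    monomial a c ∈ Ideal.span (Set.range (X : σ → MvPolynomial σ k)) := by
  obtain ⟨i, hi⟩ := Finsupp.ne_iff.1 ha
  exact Ideal.mem_of_dvd _ (X_dvd_monomial.2 (Or.inr hi))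
    (Ideal.subset_span (Set.mem_range_self i))

/-- A criterion for a labelled complex to support a minimal free resolution. -/
theorem supportsMinimalResolution_labelIdeal [Fintype V] (m : V → (σ →₀ ℕ))
    (hK : ∀ b, augmentedFaces Δ ∩ {A | faceLabel m A ≤ b} ⊆ {∅} ∨
      Acyclic k (augmentedFaces Δ ∩ {A | faceLabel m A ≤ b}))
    (hm : ∀ A ∈ Δ, ∀ v ∈ A, ¬ faceLabel m A ≤ faceLabel m (A.erase v)) :
    SupportsMinimalResolution Δ k m (labelIdeal k m) where
  free _ := inferInstance
  exact_succ i z := by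
    constructor
    · intro hz
      obtain ⟨u, hu, hu'⟩ := exists_labelledBoundary_eq m hK (z := extendChain z)
        (fun A => extendChain_ne_zero) (by rw [← extendChain_boundary, hz, extendChain_zero])
      obtain ⟨f, rfl⟩ := exists_extendChain_eq hu
      exact ⟨f, extendChain_injective ((extendChain_boundary m f).trans hu')⟩
    · rintro ⟨f, rfl⟩
      apply extendChain_injective
      rw [extendChain_boundary, extendChain_boundary, labelledBoundary_labelledBoundary,
        extendChain_zero]
  exact_zero := exact_boundary_augmentation m
  surjective x := by
    obtain ⟨s, rfl⟩ := Ideal.Quotient.mk_surjective x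
    exact ⟨Finsupp.single (emptyFace Δ) s, by rw [augmentation_apply, Finsupp.single_eq_same]⟩
  minimal i := by
    rintro _ ⟨f, rfl⟩
    induction f using Finsupp.induction_linear with
    | zero => simp
    | add f g hf hg =>
      rw [map_add]
      exact add_mem hf hg
    | single F s =>
      rw [boundary_single]
      refine Submodule.sum_mem _ fun v _ => ?_
      rw [← smul_eq_mul, ← Finsupp.smul_single]
      refine Submodule.smul_mem_smul (monomial_mem_span_X (fun h => ?_) _) Submodule.mem_top
      have hF : F.1 ∈ Δ := F.2.2.resolve_left (Finset.ne_empty_of_mem v.2)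
      exact hm F.1 hF v.1 v.2 (tsub_eq_zero_iff_le.1 h)

end Resolution

/-! ### The squarefree labelling with one variable per face -/

section NearlyScarf

variable {V : Type*}

/-- An antichain of monomials consists of the minimal generators of the ideal that it generates. -/
lemma minGens_labelIdeal {σ k : Type*} [Field k] {m : V → (σ →₀ ℕ)}
    (hm : ∀ v w, m v ≤ m w → v = w) : minGens (labelIdeal k m) = Set.range m := by
  ext b
  change Minimal (fun b => monomial b (1 : k) ∈ labelIdeal k m) b ↔ _
  simp only [monomial_mem_labelIdeal_iff]
  constructor
  · rintro ⟨⟨v, hv⟩, hmin⟩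
    exact ⟨v, le_antisymm hv (hmin ⟨v, le_rfl⟩ hv)⟩
  · rintro ⟨v, rfl⟩
    refine ⟨⟨v, le_rfl⟩, ?_⟩
    rintro a ⟨w, hw⟩ ha
    rwa [← hm w v (hw.trans ha)]

lemma isScarfComplexVia_iff {σ k : Type*} [Field k] (Δ : AbstractSimplicialComplex V)
    (I : Ideal (MvPolynomial σ k)) (φ : V ≃ minGens I) :
    IsScarfComplexVia Δ I φ ↔ ∀ F : Finset V, F ∈ Δ ↔ F.Nonempty ∧
      ∀ B, faceLabel (fun v => (φ v : σ →₀ ℕ)) B = faceLabel (fun v => (φ v : σ →₀ ℕ)) F →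
        B = F := by
  have hlab : ∀ F : Finset V, faceLabel Subtype.val (F.map φ.toEmbedding) =
      faceLabel (fun v => (φ v : σ →₀ ℕ)) F := fun F => Finset.sup_map _ _ _
  refine forall_congr' fun F => iff_congr Iff.rfl ?_
  have : F.map φ.toEmbedding ∈ scarfComplex I ↔ (F.map φ.toEmbedding).Nonempty ∧
      ∀ B : Finset (minGens I), faceLabel Subtype.val B =
        faceLabel Subtype.val (F.map φ.toEmbedding) → B = F.map φ.toEmbedding := Iff.rfl
  rw [this, Finset.map_nonempty]
  refine and_congr_right fun _ => ?_
  rw [(Equiv.finsetCongr φ).symm.forall_congr_left]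
  refine forall_congr' fun B => ?_
  simp only [Equiv.symm_symm, Equiv.finsetCongr_apply, hlab, Finset.map_inj]

variable {σ : Type*} [Finite σ] [DecidableEq V]

/-- The squarefree label of `v`: the product of the variables `i` such that `v ∉ e i`. -/
noncomputable def nearlyScarfLabel (e : σ → Finset V) (v : V) : σ →₀ ℕ :=
  Finsupp.equivFunOnFinite.symm fun i => if v ∈ e i then 0 else 1

lemma faceLabel_nearlyScarfLabel (e : σ → Finset V) (A : Finset V) (i : σ) :
    faceLabel (nearlyScarfLabel e) A i = if A ⊆ e i then 0 else 1 := by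
  induction A using Finset.induction_on with
  | empty => simp [faceLabel, bot_eq_zero]
  | insert v A _ ih =>
    rw [faceLabel, Finset.sup_insert, Finsupp.sup_apply, ← faceLabel, ih]
    by_cases h1 : v ∈ e i <;> by_cases h2 : A ⊆ e i <;>
      simp [nearlyScarfLabel, h1, h2, Finset.insert_subset_iff]

lemma faceLabel_nearlyScarfLabel_le_iff (e : σ → Finset V) (A : Finset V) (b : σ →₀ ℕ) :
    faceLabel (nearlyScarfLabel e) A ≤ b ↔ ∀ i, b i = 0 → A ⊆ e i := by
  refine forall_congr' fun i => ?_
  rw [faceLabel_nearlyScarfLabel]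
  split_ifs with h <;> simp [h]
  omega

/-- The variable indexed by `B` itself does not divide the label of `B`, hence not that of `A`,
which means `A ⊆ B`. -/
lemma subset_of_faceLabel_le {e : σ → Finset V} {A B : Finset V} (hB : B ∈ Set.range e)
    (h : faceLabel (nearlyScarfLabel e) A ≤ faceLabel (nearlyScarfLabel e) B) : A ⊆ B := by
  obtain ⟨i, rfl⟩ := hB
  exact (faceLabel_nearlyScarfLabel_le_iff e A _).1 h i (by simp [faceLabel_nearlyScarfLabel])

end NearlyScarf

/-! ### Bounded subcomplexes and the Scarf property -/

section NearlyScarf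

variable {V : Type*} [LinearOrder V] {σ : Type*} [Finite σ]
  {Δ : AbstractSimplicialComplex V} {e : σ → Finset V}

lemma nearlyScarfLabel_subcomplex [Fintype V] (he : Set.range e = augmentedFaces Δ)
    {k : Type*} [Field k]
    (hΔ : Acyclic k (augmentedFaces Δ)) (b : σ →₀ ℕ) :
    augmentedFaces Δ ∩ {A | faceLabel (nearlyScarfLabel e) A ≤ b} ⊆ {∅} ∨
      Acyclic k (augmentedFaces Δ ∩ {A | faceLabel (nearlyScarfLabel e) A ≤ b}) := by
  classical
  simp only [faceLabel_nearlyScarfLabel_le_iff]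
  by_cases hb : ∃ i, b i = 0
  · obtain ⟨i₀, hi₀⟩ := hb
    -- `W` is the intersection of the faces whose variables do not divide x^b. It lies in the face
    -- `e i₀`, so all its subsets are faces.
    set W : Finset V := Finset.univ.filter fun v => ∀ i, b i = 0 → v ∈ e i with hW
    have : augmentedFaces Δ ∩ {A | ∀ i, b i = 0 → A ⊆ e i} = Set.Iic W := by
      ext A
      constructor
      · rintro ⟨-, hA⟩ v hv
        simp only [hW, Finset.mem_filter, Finset.mem_univ, true_and]
        exact fun i hi => hA i hi hv
      · intro hA
        have hA' : ∀ i, b i = 0 → A ⊆ e i := fun i hi v hv =>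
          (Finset.mem_filter.1 (hA hv)).2 i hi
        exact ⟨isLowerSet_augmentedFaces Δ (hA' i₀ hi₀) (he ▸ Set.mem_range_self i₀), hA'⟩
    rw [this]
    rcases W.eq_empty_or_nonempty with h | h
    · exact Or.inl fun A hA => Finset.subset_empty.1 (h ▸ hA)
    · exact Or.inr (acyclic_Iic h)
  · right
    have : {A : Finset V | ∀ i, b i = 0 → A ⊆ e i} = Set.univ :=
      Set.eq_univ_of_forall fun A i hi => absurd ⟨i, hi⟩ hb
    rwa [this, Set.inter_univ]

/-- The variable of a face separates it from all other sets. A non-face is contained in no face, so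
its label is the product of all variables, which a second non-face shares. -/
lemma mem_iff_forall_faceLabel_eq (he : Set.range e = augmentedFaces Δ)
    (hΔ : ∀ B ∉ augmentedFaces Δ, ∃ C, C ∉ augmentedFaces Δ ∧ C ≠ B) (A : Finset V) :
    A ∈ Δ ↔ A.Nonempty ∧ ∀ B,
      faceLabel (nearlyScarfLabel e) B = faceLabel (nearlyScarfLabel e) A → B = A := by
  constructor
  · intro hA
    refine ⟨(Δ.isRelLowerSet_faces hA).1, fun B hB => ?_⟩
    have hAK : A ∈ augmentedFaces Δ := Or.inr hA
    have hBA : B ⊆ A := subset_of_faceLabel_le (he ▸ hAK) hB.le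
    exact subset_antisymm hBA
      (subset_of_faceLabel_le (he ▸ isLowerSet_augmentedFaces Δ hBA hAK) hB.ge)
  · rintro ⟨hne, hA⟩
    by_contra hAΔ
    have hAK : A ∉ augmentedFaces Δ := fun h => h.elim hne.ne_empty hAΔ
    obtain ⟨C, hC, hCA⟩ := hΔ A hAK
    have hone : ∀ D ∉ augmentedFaces Δ, ∀ i, ¬ D ⊆ e i := fun D hD i h =>
      hD (isLowerSet_augmentedFaces Δ h (he ▸ Set.mem_range_self i))
    refine hCA (hA C ?_)
    ext i
    rw [faceLabel_nearlyScarfLabel, faceLabel_nearlyScarfLabel, if_neg (hone C hC i),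
      if_neg (hone A hAK i)]

end NearlyScarf

end SimplicialTree

theorem mainTheorem4 {V : Type*} [Finite V] [LinearOrder V] (Δ : AbstractSimplicialComplex V)
    (hΔ : SimplicialTree.IsTree Δ) (k : Type*) [Field k] :
    ∃ (n : ℕ) (I : Ideal (MvPolynomial (Fin n) k)),
      SimplicialTree.IsMonomialIdeal I ∧
      ∃ φ : V ≃ SimplicialTree.minGens I,
        SimplicialTree.IsScarfComplexVia Δ I φ ∧
        SimplicialTree.SupportsMinimalResolution Δ k (fun v => (φ v : Fin n →₀ ℕ)) I := by
  classical
  have := Fintype.ofFinite V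
  -- The variable of the empty face divides every vertex label, so that no label is 1 even if `V` is
  -- a single point.
  set σ := Fin (Nat.card (SimplicialTree.augmentedFaces Δ))
  set e : σ → Finset V := fun i =>
    ((Finite.equivFin (SimplicialTree.augmentedFaces Δ)).symm i : Finset V) with he_def
  have he : Set.range e = SimplicialTree.augmentedFaces Δ := by
    rw [he_def, ← Function.comp_def, Set.range_comp, Equiv.range_eq_univ, Set.image_univ,
      Subtype.range_coe]
  set m := SimplicialTree.nearlyScarfLabel e with hm_def
  have hm : ∀ v w, m v ≤ m w → v = w := fun v w h => by
    have hw : ({w} : Finset V) ∈ Set.range e := he ▸ Or.inr (Δ.singleton_mem w)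
    exact Finset.singleton_subset_singleton.1 (SimplicialTree.subset_of_faceLabel_le hw
      (by simpa [SimplicialTree.faceLabel] using h))
  have hrange := SimplicialTree.minGens_labelIdeal (k := k) hm
  refine ⟨_, SimplicialTree.labelIdeal k m, ⟨Set.range m, rfl⟩,
    (Equiv.ofInjective m fun v w h => hm v w h.le).trans (Equiv.setCongr hrange.symm), ?_, ?_⟩
  · rw [SimplicialTree.isScarfComplexVia_iff]
    exact SimplicialTree.mem_iff_forall_faceLabel_eq he fun B => hΔ.exists_nonface_ne
  · refine SimplicialTree.supportsMinimalResolution_labelIdeal m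
      (SimplicialTree.nearlyScarfLabel_subcomplex he (hΔ.acyclic_augmentedFaces k)) ?_
    intro A hA v hv h
    -- `A.erase v` is a face, possibly empty, so it has a variable of its own, and this divides the
    -- label of `A` but not that of `A.erase v`.
    have hA' : A.erase v ∈ Set.range e := he ▸ SimplicialTree.isLowerSet_augmentedFaces Δ
      (Finset.erase_subset v A) (Or.inr hA)
    exact Finset.notMem_erase v A (SimplicialTree.subset_of_faceLabel_le hA' h hv)
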